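/- Let $0<T<\infty$, $\Omega=\{(x,t): 0\le x<\infty,\ 0\le t<T\}$, and let $u:\Omega\to\mathbb R$ be a $C^3$ solution of the Degasperis–Procesi equation $u_t-u_{txx}+3u_x+4uu_x-3u_xu_{xx}-uu_{xxx}=0$ such that $u,u_x,u_{xx}\to0$ as $x\to\infty$ for each $t$, $u(x,0)-u_{xx}(x,0)+1>0$ for $x\ge0$ and $u(0,t)-u_{xx}(0,t)+1>0$ for $0\le t<T$. Put $q=(u-u_{xx}+1)^{1/3}$, $\omega=e^{2\pi i/3}$, $\lambda(k)=\frac{1}{3\sqrt3}(k^3+k^{-3})$ and, for $j=1,2,3$, $$l_j(k)=\tfrac1{\sqrt3}\Bigl(\omega^jk+\tfrac1{\omega^jk}\Bigr),\qquad z_j(k)=\sqrt3\,\frac{(\omega^jk)^2+(\omega^jk)^{-2}}{k^3+k^{-3}},$$ $\mathcal L=\mathrm{diag}(l_1,l_2,l_3)$, $\mathcal Z=\mathrm{diag}(z_1,z_2,z_3)$, $P(k)=\bigl(l_j(k)^{i-1}\bigr)_{i,j=1}^3$, $$V_1=P^{-1}\begin{pmatrix}0&0&0\\0&0&0\\ \lambda(q^3-1)&0&0\end{pmatrix}P,\qquad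 V_2=P^{-1}\begin{pmatrix}u_x&-u&0\\u&0&-u\\u_x-\lambda uq^3&0&-u_x\end{pmatrix}P .$$ Write $e^{\hat D}M=e^DMe^{-D}$ for diagonal $D$. For permutations $(a,b,c)$ and $(a',b',c')$ of $(1,2,3)$ let $D_{abc|a'b'c'}$ be the set of $k\in\mathbb C\setminus\{0\}$ with $k^3+k^{-3}\ne0$, $\mathrm{Re}\,l_a<\mathrm{Re}\,l_b<\mathrm{Re}\,l_c$ and $\mathrm{Re}\,z_{a'}<\mathrm{Re}\,z_{b'}<\mathrm{Re}\,z_{c'}$. The sets $D_1,\dots,D_{18}$ are those with the following indices, in this order: $123|123$, $132|132$, $312|312$, $321|321$, $231|231$, $213|213$, $123|213$, $123|132$, $132|123$, $132|312$, $312|132$, $312|321$, $321|312$, $321|231$, $231|321$, $231|213$, $213|231$, $213|123$. Let $\gamma_1$ be the path $(0,T)\to(0,t)\to(x,t)$, $\gamma_2$ the path $(0,0)\to(0,t)\to(x,t)$ and $\gamma_3$ the path $(\infty,t)\to(x,t)$, all made of straight segments. For $k\in D_n$ put $\gamma^n_{ij}=\gamma_1$ if $\mathrm{Re}\,l_i<\mathrm{Re}\,l_j$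 and $\mathrm{Re}\,z_i\ge\mathrm{Re}\,z_j$, $\gamma^n_{ij}=\gamma_2$ if $\mathrm{Re}\,l_i<\mathrm{Re}\,l_j$ and $\mathrm{Re}\,z_i<\mathrm{Re}\,z_j$, and $\gamma^n_{ij}=\gamma_3$ if $\mathrm{Re}\,l_i\ge\mathrm{Re}\,l_j$. For $k\in D_n$, $\Phi_n(\cdot,\cdot,k):\Omega\to\mathbb C^{3\times3}$ is the solution, bounded in $x$ for each $t$, of the Lax pair $\Phi_x-[\mathcal L,\Phi]=V_1\Phi$, $\Phi_t-[\mathcal Z,\Phi]=V_2\Phi$ that satisfies the integral equations (with absolutely convergent integrals) $$(\Phi_n)_{ij}(x,t,k)=\delta_{ij}+\int_{\gamma^n_{ij}}\Bigl(e^{\hat{\mathcal L}(k)x+\hat{\mathcal Z}(k)t}\,e^{-\hat{\mathcal L}(k)x'-\hat{\mathcal Z}(k)t'}\bigl[(V_1\,dx'+V_2\,dt')\Phi_n\bigr](x',t',k)\Bigr)_{ij},\qquad i,j=1,2,3 ;$$ it is well-defined at those $k\in D_n$ at which such a solution exists and is unique. Let $\Phi_*=\Phi_n$ on the set of $k\in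 D_n$ at which $\Phi_n$ is well-defined, $n=1,\dots,18$, and let $\mathcal D\subset\mathbb C$ be the resulting domain of $\Phi_*$ in $k$. Let $$\mathcal A=\begin{pmatrix}0&0&1\\1&0&0\\0&1&0\end{pmatrix},\qquad \mathcal B=\begin{pmatrix}0&1&0\\1&0&0\\0&0&1\end{pmatrix}.$$ Then, for every $k\in\mathcal D$, also $\omega k,\ \bar k,\ 1/k\in\mathcal D$, and for all $(x,t)\in\Omega$ $$\Phi_*(x,t,k)=\mathcal A\,\Phi_*(x,t,\omega k)\,\mathcal A^{-1},\qquad \Phi_*(x,t,k)=\mathcal B\,\overline{\Phi_*(x,t,\bar k)}\,\mathcal B,\qquad \Phi_*(x,t,k)=\mathcal B\,\Phi_*(x,t,1/k)\,\mathcal B .$$ -/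

import Mathlib

open scoped Matrix ComplexConjugate

noncomputable section

namespace DPHalfLine

/-! The indices `1, 2, 3` of the mathematics are the elements `0, 1, 2` of `Fin 3`. -/

/-- Complex `3 × 3` matrices. -/
abbrev Mat3 := Matrix (Fin 3) (Fin 3) ℂ

/-- The half-line domain `0 ≤ x < ∞`, `0 ≤ t < T`, with points `(x, t)`. -/
def Omega (T : ℝ) : Set (ℝ × ℝ) := Set.Ici 0 ×ˢ Set.Ico 0 T

/-- Partial derivative in `x` on `0 ≤ x < ∞` (one-sided at `x = 0`). -/
def dx (f : ℝ → ℝ → ℝ) (x t : ℝ) : ℝ := derivWithin (fun x' => f x' t) (Set.Ici 0) x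

/-- Partial derivative in `t` on `0 ≤ t < T` (one-sided at `t = 0`). -/
def dt (T : ℝ) (f : ℝ → ℝ → ℝ) (x t : ℝ) : ℝ := derivWithin (fun t' => f x t') (Set.Ico 0 T) t

/-- `u` is a classical solution of the Degasperis-Procesi equation with `κ = 1` on the half-line
domain, decaying as `x → ∞`, whose initial and boundary values satisfy the positivity
conditions `u₀ - u₀'' + 1 > 0` and `g₀ - g₂ + 1 > 0`. -/
structure IsDPSolution (T : ℝ) (u : ℝ → ℝ → ℝ) : Prop where
  contDiffOn : ContDiffOn ℝ 3 (fun p : ℝ × ℝ => u p.1 p.2) (Omega T)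
  equation : ∀ x t : ℝ, (x, t) ∈ Omega T →
    dt T u x t - dx (dx (dt T u)) x t + 3 * dx u x t + 4 * u x t * dx u x t
      - 3 * dx u x t * dx (dx u) x t - u x t * dx (dx (dx u)) x t = 0
  decay : ∀ t ∈ Set.Ico 0 T, Filter.Tendsto (fun x => u x t) Filter.atTop (nhds 0)
  decay_dx : ∀ t ∈ Set.Ico 0 T, Filter.Tendsto (fun x => dx u x t) Filter.atTop (nhds 0)
  decay_dxx : ∀ t ∈ Set.Ico 0 T, Filter.Tendsto (fun x => dx (dx u) x t) Filter.atTop (nhds 0)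
  pos_initial : ∀ x : ℝ, 0 ≤ x → 0 < u x 0 - dx (dx u) x 0 + 1
  pos_boundary : ∀ t ∈ Set.Ico 0 T, 0 < u 0 t - dx (dx u) 0 t + 1

/-- `q = (u - u_xx + 1)^(1/3)`. -/
def q (u : ℝ → ℝ → ℝ) (x t : ℝ) : ℝ := (u x t - dx (dx u) x t + 1) ^ (1 / 3 : ℝ)

/-- `ω = exp(2πi/3)`. -/
def omega : ℂ := Complex.exp (2 * Real.pi * Complex.I / 3)

/-- `λ(k) = (k³ + k⁻³) / (3√3)`. -/
def lam (k : ℂ) : ℂ := 1 / (3 * (Real.sqrt 3 : ℂ)) * (k ^ 3 + 1 / k ^ 3)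

/-- `l_j(k) = (ω^j k + (ω^j k)⁻¹) / √3`. -/
def l (k : ℂ) (j : Fin 3) : ℂ :=
  1 / (Real.sqrt 3 : ℂ) * (omega ^ (j.val + 1) * k + 1 / (omega ^ (j.val + 1) * k))

/-- `z_j(k) = √3 ((ω^j k)² + (ω^j k)⁻²) / (k³ + k⁻³)`. -/
def z (k : ℂ) (j : Fin 3) : ℂ :=
  (Real.sqrt 3 : ℂ) * (((omega ^ (j.val + 1) * k) ^ 2 + 1 / (omega ^ (j.val + 1) * k) ^ 2) /
    (k ^ 3 + 1 / k ^ 3))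

/-- The matrix `P(k)` with rows `(1, 1, 1)`, `(l₁, l₂, l₃)`, `(l₁², l₂², l₃²)`. -/
def P (k : ℂ) : Mat3 := Matrix.of fun i j => l k j ^ i.val

/-- `V₁`, the `x`-potential of the transformed Lax pair. -/
def V1 (u : ℝ → ℝ → ℝ) (x t : ℝ) (k : ℂ) : Mat3 :=
  (P k)⁻¹ * !![0, 0, 0; 0, 0, 0; lam k * ((q u x t : ℂ) ^ 3 - 1), 0, 0] * P k

/-- `V₂`, the `t`-potential of the transformed Lax pair. -/
def V2 (u : ℝ → ℝ → ℝ) (x t : ℝ) (k : ℂ) : Mat3 :=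
  (P k)⁻¹ * !![(dx u x t : ℂ), -(u x t : ℂ), 0;
               (u x t : ℂ), 0, -(u x t : ℂ);
               (dx u x t : ℂ) - lam k * (u x t : ℂ) * (q u x t : ℂ) ^ 3, 0, -(dx u x t : ℂ)] * P k

/-- `e^{D̂} M = e^D M e^{-D}` for the diagonal matrix `D = diag(d)`. -/
def expHat (d : Fin 3 → ℂ) (M : Mat3) : Mat3 :=
  Matrix.diagonal (fun i => Complex.exp (d i)) * M * Matrix.diagonal (fun i => Complex.exp (-d i))

/-- The diagonal of `x 𝓛(k) + t 𝓩(k)`. -/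
def phase (x t : ℝ) (k : ℂ) (i : Fin 3) : ℂ := l k i * x + z k i * t

/-- The `dx`-component of the one-form `W = e^{-x𝓛̂ - t𝓩̂} (V₁ dx + V₂ dt) Φ`. -/
def W1 (u : ℝ → ℝ → ℝ) (Φ : ℝ → ℝ → Mat3) (x t : ℝ) (k : ℂ) : Mat3 :=
  expHat (-phase x t k) (V1 u x t k * Φ x t)

/-- The `dt`-component of the one-form `W = e^{-x𝓛̂ - t𝓩̂} (V₁ dx + V₂ dt) Φ`. -/
def W2 (u : ℝ → ℝ → ℝ) (Φ : ℝ → ℝ → Mat3) (x t : ℝ) (k : ℂ) : Mat3 :=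
  expHat (-phase x t k) (V2 u x t k * Φ x t)

/-- The three contours `γ₁, γ₂, γ₃`. Those ending at `(x, t)` are
`γ₁ : (0, T) → (0, t) → (x, t)`, `γ₂ : (0, 0) → (0, t) → (x, t)` and `γ₃ : (∞, t) → (x, t)`,
all composed of straight segments. -/
inductive Contour
  | one
  | two
  | three

/-- The integral of the one-form `f dx' + g dt'` along a contour ending at `(x, t)`. -/
def contourIntegral (T : ℝ) (γ : Contour) (f g : ℝ → ℝ → ℂ) (x t : ℝ) : ℂ :=
  match γ with
  | Contour.one => (∫ t' in T..t, g 0 t') + ∫ x' in (0 : ℝ)..x, f x' t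
  | Contour.two => (∫ t' in (0 : ℝ)..t, g 0 t') + ∫ x' in (0 : ℝ)..x, f x' t
  | Contour.three => -∫ x' in Set.Ioi x, f x' t

/-- Absolute convergence of the integral of `f dx' + g dt'` along a contour ending at `(x, t)`. -/
def ContourIntegrable (T : ℝ) (γ : Contour) (f g : ℝ → ℝ → ℂ) (x t : ℝ) : Prop :=
  match γ with
  | Contour.one => IntervalIntegrable (fun t' => g 0 t') MeasureTheory.volume T t ∧
      IntervalIntegrable (fun x' => f x' t) MeasureTheory.volume 0 x
  | Contour.two => IntervalIntegrable (fun t' => g 0 t') MeasureTheory.volume 0 t ∧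
      IntervalIntegrable (fun x' => f x' t) MeasureTheory.volume 0 x
  | Contour.three => MeasureTheory.IntegrableOn (fun x' => f x' t) (Set.Ioi x)

open Classical in
/-- The contour `γ_{ij}` attached to the entry `(i, j)`; it is constant for `k` in each `D n`. -/
def contour (k : ℂ) (i j : Fin 3) : Contour :=
  if (l k i).re < (l k j).re then
    if (z k j).re ≤ (z k i).re then Contour.one else Contour.two
  else Contour.three

/-- `Re f_a < Re f_b < Re f_c` for `p = (a, b, c)`. -/
def Ordered (f : Fin 3 → ℂ) (p : Fin 3 × Fin 3 × Fin 3) : Prop :=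
  (f p.1).re < (f p.2.1).re ∧ (f p.2.1).re < (f p.2.2).re

/-- For `D₁, …, D₁₈`: the indices listed by increasing real part of the `l_j`. -/
def lOrder : Fin 18 → Fin 3 × Fin 3 × Fin 3 :=
  ![(0, 1, 2), (0, 2, 1), (2, 0, 1), (2, 1, 0), (1, 2, 0), (1, 0, 2),
    (0, 1, 2), (0, 1, 2), (0, 2, 1), (0, 2, 1), (2, 0, 1), (2, 0, 1),
    (2, 1, 0), (2, 1, 0), (1, 2, 0), (1, 2, 0), (1, 0, 2), (1, 0, 2)]

/-- For `D₁, …, D₁₈`: the indices listed by increasing real part of the `z_j`. -/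
def zOrder : Fin 18 → Fin 3 × Fin 3 × Fin 3 :=
  ![(0, 1, 2), (0, 2, 1), (2, 0, 1), (2, 1, 0), (1, 2, 0), (1, 0, 2),
    (1, 0, 2), (0, 2, 1), (0, 1, 2), (2, 0, 1), (0, 2, 1), (2, 1, 0),
    (2, 0, 1), (1, 2, 0), (2, 1, 0), (1, 0, 2), (1, 2, 0), (0, 1, 2)]

/-- The sets `D₁, …, D₁₈`. The poles of the `l_j` and `z_j` (`0`, `∞` and the zeros of `λ`) are
not in any of them: at `0` all the values `l k j`, and at the zeros of `λ` all the values `z k j`,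
are `0` by convention, so that the strict inequalities fail. -/
def D (n : Fin 18) : Set ℂ := {k | Ordered (l k) (lOrder n) ∧ Ordered (z k) (zOrder n)}

/-- `Φ` is, for the spectral parameter `k`, an eigenfunction: a solution on the half-line domain of
the Lax pair `Φ_x - [𝓛, Φ] = V₁ Φ`, `Φ_t - [𝓩, Φ] = V₂ Φ` and of the integral equations
`Φ_ij = δ_ij + ∫_{γ_ij} (e^{x𝓛̂ + t𝓩̂} W)_ij` (the integrals converging absolutely),
bounded in `x` for each `t`. -/
structure IsEigenfunction (T : ℝ) (u : ℝ → ℝ → ℝ) (k : ℂ) (Φ : ℝ → ℝ → Mat3) : Prop where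
  lax_x : ∀ x t : ℝ, (x, t) ∈ Omega T → ∀ i j : Fin 3,
    HasDerivWithinAt (fun x' => Φ x' t i j)
      ((Matrix.diagonal (l k) * Φ x t - Φ x t * Matrix.diagonal (l k)
        + V1 u x t k * Φ x t) i j) (Set.Ici 0) x
  lax_t : ∀ x t : ℝ, (x, t) ∈ Omega T → ∀ i j : Fin 3,
    HasDerivWithinAt (fun t' => Φ x t' i j)
      ((Matrix.diagonal (z k) * Φ x t - Φ x t * Matrix.diagonal (z k)
        + V2 u x t k * Φ x t) i j) (Set.Ico 0 T) t
  bounded : ∀ t ∈ Set.Ico 0 T, ∃ C : ℝ, ∀ x : ℝ, 0 ≤ x → ∀ i j : Fin 3, ‖Φ x t i j‖ ≤ C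
  integrable : ∀ x t : ℝ, (x, t) ∈ Omega T → ∀ i j : Fin 3,
    ContourIntegrable T (contour k i j)
      (fun x' t' => expHat (phase x t k) (W1 u Φ x' t' k) i j)
      (fun x' t' => expHat (phase x t k) (W2 u Φ x' t' k) i j) x t
  integral_eq : ∀ x t : ℝ, (x, t) ∈ Omega T → ∀ i j : Fin 3,
    Φ x t i j = (1 : Mat3) i j + contourIntegral T (contour k i j)
      (fun x' t' => expHat (phase x t k) (W1 u Φ x' t' k) i j)
      (fun x' t' => expHat (phase x t k) (W2 u Φ x' t' k) i j) x t

/-- The eigenfunction at `k` is well-defined: it exists, and it is unique on the domain. -/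
def WellDefined (T : ℝ) (u : ℝ → ℝ → ℝ) (k : ℂ) : Prop :=
  ∃ Φ : ℝ → ℝ → Mat3, IsEigenfunction T u k Φ ∧
    ∀ Ψ : ℝ → ℝ → Mat3, IsEigenfunction T u k Ψ → ∀ x t : ℝ, (x, t) ∈ Omega T → Ψ x t = Φ x t

open Classical in
/-- `Φ_n(x, t, k)` for `k ∈ D n` outside the singular set; `0` for all other `k`. -/
def Phi (T : ℝ) (u : ℝ → ℝ → ℝ) (n : Fin 18) (x t : ℝ) (k : ℂ) : Mat3 :=
  if h : k ∈ D n ∧ WellDefined T u k then h.2.choose x t else 0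

open Classical in
/-- The sectionally defined function `Φ_*`, equal to `Φ_n` on `D n`; see `PhiStar_eq`. -/
def PhiStar (T : ℝ) (u : ℝ → ℝ → ℝ) (x t : ℝ) (k : ℂ) : Mat3 :=
  if h : ∃ n, k ∈ D n then Phi T u h.choose x t k else 0

theorem PhiStar_eq (T : ℝ) (u : ℝ → ℝ → ℝ) (n : Fin 18) (x t : ℝ) (k : ℂ) (hk : k ∈ D n) :
    PhiStar T u x t k = Phi T u n x t k := by
  have h : ∃ n, k ∈ D n := ⟨n, hk⟩
  have h' : k ∈ D h.choose := h.choose_spec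
  by_cases hw : WellDefined T u k
  · simp only [PhiStar, Phi]
    rw [dif_pos h, dif_pos ⟨h', hw⟩, dif_pos ⟨hk, hw⟩]
  · simp [PhiStar, Phi, hw]

/-- The domain of `Φ_*`: the points of the sets `D n` at which the eigenfunction is well-defined. -/
def domain (T : ℝ) (u : ℝ → ℝ → ℝ) : Set ℂ := {k | (∃ n, k ∈ D n) ∧ WellDefined T u k}

/-- The matrix `𝓐`. -/
def A : Mat3 := !![0, 0, 1; 1, 0, 0; 0, 1, 0]

/-- The matrix `𝓑`. -/
def B : Mat3 := !![0, 1, 0; 1, 0, 0; 0, 0, 1]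

end DPHalfLine

end

/-!
The exponents `l_j`, `z_j` are the values at `ω^j k` of rational functions invariant under
`κ ↦ κ⁻¹`, and `λ` is the value of such a function at any of the three points `ω^j k`. Each of the
maps `k ↦ ω k`, `k ↦ conj k`, `k ↦ 1 / k` permutes these points, up to inversion and complex
conjugation, so it permutes the columns of `P` and the sets `D_n`. Because `u`, `u_x` and `q` are
real, the Lax pair, the contours and the integral equations at the new point are those at `k` with
the indices permuted and the entries conjugated where necessary. Permuting and conjugating
therefore turns eigenfunctions into eigenfunctions, and uniqueness identifies the result with
`Φ_*`. Conjugation by `𝓐` and by `𝓑` is the corresponding permutation of the indices.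
-/

namespace DPHalfLine

section RealAutomorphism

theorem algEquiv_eq_refl_or_eq_conjAe (τ : ℂ ≃ₐ[ℝ] ℂ) : τ = AlgEquiv.refl ∨ τ = Complex.conjAe :=
  (Complex.real_algHom_eq_id_or_conj τ).imp (fun h ↦ AlgEquiv.coe_toAlgHom_injective h)
    fun h ↦ AlgEquiv.coe_toAlgHom_injective h

variable (τ : ℂ ≃ₐ[ℝ] ℂ)

theorem algEquiv_re (a : ℂ) : (τ a).re = a.re := by
  obtain rfl | rfl := algEquiv_eq_refl_or_eq_conjAe τ <;> simp

theorem algEquiv_norm (a : ℂ) : ‖τ a‖ = ‖a‖ := by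
  obtain rfl | rfl := algEquiv_eq_refl_or_eq_conjAe τ <;> simp

theorem algEquiv_exp (a : ℂ) : τ (Complex.exp a) = Complex.exp (τ a) := by
  obtain rfl | rfl := algEquiv_eq_refl_or_eq_conjAe τ <;> simp [Complex.exp_conj]

theorem algEquiv_ofReal (r : ℝ) : τ r = r :=
  τ.commutes r

/-- A real automorphism of `ℂ` as a linear isometry, the form in which it commutes with
derivatives and integrals. -/
noncomputable def algEquivLinearIsometry : ℂ →ₗᵢ[ℝ] ℂ where
  __ := τ.toLinearMap
  norm_map' := algEquiv_norm τ

end RealAutomorphism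

theorem contourIntegral_linearIsometry (L : ℂ →ₗᵢ[ℝ] ℂ) (T : ℝ) (γ : Contour) (f g : ℝ → ℝ → ℂ)
    (x t : ℝ) :
    contourIntegral T γ (fun x' t' ↦ L (f x' t')) (fun x' t' ↦ L (g x' t')) x t =
      L (contourIntegral T γ f g x t) := by
  cases γ <;> simp only [contourIntegral, L.intervalIntegral_comp_comm, L.integral_comp_comm,
    map_add, map_neg]

theorem ContourIntegrable.continuousLinearMap (L : ℂ →L[ℝ] ℂ) {T : ℝ} {γ : Contour}
    {f g : ℝ → ℝ → ℂ} {x t : ℝ} (h : ContourIntegrable T γ f g x t) :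
    ContourIntegrable T γ (fun x' t' ↦ L (f x' t')) (fun x' t' ↦ L (g x' t')) x t :=
  have interval {φ : ℝ → ℂ} {a b : ℝ} (hφ : IntervalIntegrable φ MeasureTheory.volume a b) :
      IntervalIntegrable (fun s ↦ L (φ s)) MeasureTheory.volume a b :=
    ⟨L.integrable_comp hφ.1, L.integrable_comp hφ.2⟩
  match γ, h with
  | .one, h | .two, h => ⟨interval h.1, interval h.2⟩
  | .three, h => L.integrable_comp h

section Matrix

variable {n : Type*} [Fintype n] [DecidableEq n]

theorem matrix_map_inv {K L : Type*} [Field K] [Field L] (f : K →+* L) (M : Matrix n n K) :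
    (M.map f)⁻¹ = M⁻¹.map f := by
  have hdet : (M.map f).det = f M.det := (f.map_det M).symm
  have hadj : (M.map f).adjugate = M.adjugate.map f := (f.map_adjugate M).symm
  ext i j
  simp [Matrix.inv_def, hdet, hadj, Ring.inverse_eq_inv']

theorem permMatrix_conj {R : Type*} [NonAssocSemiring R] (σ : Equiv.Perm n) (M : Matrix n n R) :
    σ⁻¹.permMatrix R * M * σ.permMatrix R = Matrix.reindex σ σ M := by
  rw [PEquiv.toMatrix_toPEquiv_mul, PEquiv.mul_toMatrix_toPEquiv]
  rfl

theorem permMatrix_inv {R : Type*} [CommRing R] (σ : Equiv.Perm n) :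
    (σ.permMatrix R)⁻¹ = σ⁻¹.permMatrix R :=
  Matrix.inv_eq_right_inv <| by rw [← Matrix.permMatrix_mul, inv_mul_cancel, Matrix.permMatrix_one]

/-- The automorphism of the matrix algebra that applies `τ` to the entries and moves the entry
`(i, j)` to the place `(σ i, σ j)`. -/
def mapReindex {R α : Type*} [CommSemiring R] [Semiring α] [Algebra R α] (τ : α ≃ₐ[R] α)
    (σ : Equiv.Perm n) : Matrix n n α ≃ₐ[R] Matrix n n α :=
  τ.mapMatrix.trans (Matrix.reindexAlgEquiv R α σ)

section Semiring

variable {R α : Type*} [CommSemiring R] [Semiring α] [Algebra R α]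
  (τ : α ≃ₐ[R] α) (σ : Equiv.Perm n)

theorem mapReindex_apply (M : Matrix n n α) (i j : n) :
    mapReindex τ σ M i j = τ (M (σ.symm i) (σ.symm j)) :=
  rfl

theorem mapReindex_symm : (mapReindex τ σ).symm = mapReindex τ.symm σ.symm :=
  rfl

theorem mapReindex_diagonal (d : n → α) :
    mapReindex τ σ (Matrix.diagonal d) = Matrix.diagonal fun i ↦ τ (d (σ.symm i)) := by
  ext i j
  simp [mapReindex_apply, Matrix.diagonal_apply, apply_ite τ]

end Semiring

theorem mapReindex_inv_mul_mul {R K : Type*} [CommSemiring R] [Field K] [Algebra R K]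
    (τ : K ≃ₐ[R] K) (σ : Equiv.Perm n) (N X : Matrix n n K) :
    mapReindex τ σ (X⁻¹ * N * X) =
      ((X.map τ).submatrix id σ.symm)⁻¹ * N.map τ * (X.map τ).submatrix id σ.symm := by
  have hinv : ((X.map τ).submatrix id σ.symm)⁻¹ = (X⁻¹.map τ).submatrix σ.symm id :=
    (Matrix.inv_submatrix_equiv (X.map τ) (Equiv.refl n) σ.symm).trans
      (congrArg (Matrix.submatrix · σ.symm id) (matrix_map_inv (τ : K →+* K) X))
  ext i j
  simp [hinv, mapReindex_apply, Matrix.mul_apply]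

theorem mapReindex_expHat (τ : ℂ ≃ₐ[ℝ] ℂ) (σ : Equiv.Perm (Fin 3)) (d : Fin 3 → ℂ)
    (M : Mat3) :
    mapReindex τ σ (expHat d M) = expHat (fun i ↦ τ (d (σ.symm i))) (mapReindex τ σ M) := by
  simp only [expHat, map_mul, mapReindex_diagonal, algEquiv_exp, map_neg]

end Matrix

/-- The permutation `σ` of the indices and the real automorphism `τ` of `ℂ` carry the spectral
functions at `k` to those at `k'`. -/
structure IsSpectralSymmetry (τ : ℂ ≃ₐ[ℝ] ℂ) (σ : Equiv.Perm (Fin 3)) (k k' : ℂ) : Prop where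
  l_eq : ∀ j, l k' (σ j) = τ (l k j)
  z_eq : ∀ j, z k' (σ j) = τ (z k j)
  lam_eq : lam k' = τ (lam k)

namespace IsSpectralSymmetry

variable {τ : ℂ ≃ₐ[ℝ] ℂ} {σ : Equiv.Perm (Fin 3)} {k k' : ℂ}

theorem symm (h : IsSpectralSymmetry τ σ k k') : IsSpectralSymmetry τ.symm σ.symm k' k where
  l_eq j := by rw [AlgEquiv.eq_symm_apply, ← h.l_eq, Equiv.apply_symm_apply]
  z_eq j := by rw [AlgEquiv.eq_symm_apply, ← h.z_eq, Equiv.apply_symm_apply]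
  lam_eq := by rw [AlgEquiv.eq_symm_apply, h.lam_eq]

theorem l_apply (h : IsSpectralSymmetry τ σ k k') (j : Fin 3) : l k' j = τ (l k (σ.symm j)) := by
  rw [← h.l_eq, Equiv.apply_symm_apply]

theorem z_apply (h : IsSpectralSymmetry τ σ k k') (j : Fin 3) : z k' j = τ (z k (σ.symm j)) := by
  rw [← h.z_eq, Equiv.apply_symm_apply]

theorem diagonal_l (h : IsSpectralSymmetry τ σ k k') :
    Matrix.diagonal (l k') = mapReindex τ σ (Matrix.diagonal (l k)) := by
  rw [mapReindex_diagonal, funext h.l_apply]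

theorem diagonal_z (h : IsSpectralSymmetry τ σ k k') :
    Matrix.diagonal (z k') = mapReindex τ σ (Matrix.diagonal (z k)) := by
  rw [mapReindex_diagonal, funext h.z_apply]

theorem phase_apply (h : IsSpectralSymmetry τ σ k k') (x t : ℝ) (i : Fin 3) :
    phase x t k' i = τ (phase x t k (σ.symm i)) := by
  simp only [phase, h.l_apply, h.z_apply, map_add, map_mul, algEquiv_ofReal]

theorem P_eq (h : IsSpectralSymmetry τ σ k k') : P k' = ((P k).map τ).submatrix id σ.symm := by
  ext i j
  simp [P, h.l_apply]

theorem V1_eq (h : IsSpectralSymmetry τ σ k k') (u : ℝ → ℝ → ℝ) (x t : ℝ) :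
    V1 u x t k' = mapReindex τ σ (V1 u x t k) := by
  rw [V1, V1, mapReindex_inv_mul_mul, h.P_eq]
  congr 2
  ext i j
  fin_cases i <;> fin_cases j <;> simp [h.lam_eq, algEquiv_ofReal]

theorem V2_eq (h : IsSpectralSymmetry τ σ k k') (u : ℝ → ℝ → ℝ) (x t : ℝ) :
    V2 u x t k' = mapReindex τ σ (V2 u x t k) := by
  rw [V2, V2, mapReindex_inv_mul_mul, h.P_eq]
  congr 2
  ext i j
  fin_cases i <;> fin_cases j <;> simp [h.lam_eq, algEquiv_ofReal]

theorem expHat_phase (h : IsSpectralSymmetry τ σ k k') (x t : ℝ) (M : Mat3) :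
    expHat (phase x t k') (mapReindex τ σ M) = mapReindex τ σ (expHat (phase x t k) M) := by
  rw [mapReindex_expHat, funext (h.phase_apply x t)]

theorem expHat_neg_phase (h : IsSpectralSymmetry τ σ k k') (x t : ℝ) (M : Mat3) :
    expHat (-phase x t k') (mapReindex τ σ M) = mapReindex τ σ (expHat (-phase x t k) M) := by
  simp only [mapReindex_expHat, Pi.neg_apply, map_neg, ← h.phase_apply]
  rfl

theorem W1_eq (h : IsSpectralSymmetry τ σ k k') (u : ℝ → ℝ → ℝ) (Φ : ℝ → ℝ → Mat3) (x t : ℝ) :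
    W1 u (fun x t ↦ mapReindex τ σ (Φ x t)) x t k' = mapReindex τ σ (W1 u Φ x t k) := by
  rw [W1, W1, h.V1_eq, ← map_mul, h.expHat_neg_phase]

theorem W2_eq (h : IsSpectralSymmetry τ σ k k') (u : ℝ → ℝ → ℝ) (Φ : ℝ → ℝ → Mat3) (x t : ℝ) :
    W2 u (fun x t ↦ mapReindex τ σ (Φ x t)) x t k' = mapReindex τ σ (W2 u Φ x t k) := by
  rw [W2, W2, h.V2_eq, ← map_mul, h.expHat_neg_phase]

theorem contour_eq (h : IsSpectralSymmetry τ σ k k') (i j : Fin 3) :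
    contour k' i j = contour k (σ.symm i) (σ.symm j) := by
  simp only [contour, h.l_apply, h.z_apply, algEquiv_re]

theorem isEigenfunction_mapReindex (h : IsSpectralSymmetry τ σ k k') {T : ℝ} {u : ℝ → ℝ → ℝ}
    {Φ : ℝ → ℝ → Mat3} (hΦ : IsEigenfunction T u k Φ) :
    IsEigenfunction T u k' fun x t ↦ mapReindex τ σ (Φ x t) where
  lax_x x t hxt i j := by
    simp only [h.diagonal_l, h.V1_eq, ← map_mul, ← map_sub, ← map_add]
    exact (algEquivLinearIsometry τ).toContinuousLinearMap.hasFDerivAt.comp_hasDerivWithinAt x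
      (hΦ.lax_x x t hxt (σ.symm i) (σ.symm j))
  lax_t x t hxt i j := by
    simp only [h.diagonal_z, h.V2_eq, ← map_mul, ← map_sub, ← map_add]
    exact (algEquivLinearIsometry τ).toContinuousLinearMap.hasFDerivAt.comp_hasDerivWithinAt t
      (hΦ.lax_t x t hxt (σ.symm i) (σ.symm j))
  bounded t ht := by
    obtain ⟨C, hC⟩ := hΦ.bounded t ht
    exact ⟨C, fun x hx i j ↦ (algEquiv_norm τ _).trans_le (hC x hx (σ.symm i) (σ.symm j))⟩
  integrable x t hxt i j := by
    simp only [h.W1_eq, h.W2_eq, h.expHat_phase, h.contour_eq]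
    exact (hΦ.integrable x t hxt (σ.symm i) (σ.symm j)).continuousLinearMap
      (algEquivLinearIsometry τ).toContinuousLinearMap
  integral_eq x t hxt i j := by
    simp only [h.W1_eq, h.W2_eq, h.expHat_phase, h.contour_eq]
    rw [← map_one (mapReindex τ σ), mapReindex_apply, mapReindex_apply,
      hΦ.integral_eq x t hxt (σ.symm i) (σ.symm j), map_add]
    exact congrArg _ (contourIntegral_linearIsometry (algEquivLinearIsometry τ) ..).symm

theorem wellDefined (h : IsSpectralSymmetry τ σ k k') {T : ℝ} {u : ℝ → ℝ → ℝ}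
    (hk : WellDefined T u k) : WellDefined T u k' := by
  obtain ⟨Φ, hΦ, hΦ_unique⟩ := hk
  refine ⟨_, h.isEigenfunction_mapReindex hΦ, fun Ψ hΨ x t hxt ↦ ?_⟩
  rw [← hΦ_unique _ (h.symm.isEigenfunction_mapReindex hΨ) x t hxt, ← mapReindex_symm,
    AlgEquiv.apply_symm_apply]

end IsSpectralSymmetry

theorem ordered_map_iff {f f' : Fin 3 → ℂ} {σ : Fin 3 → Fin 3}
    (h : ∀ j, (f' (σ j)).re = (f j).re) (p : Fin 3 × Fin 3 × Fin 3) :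
    Ordered f' (Prod.map σ (Prod.map σ σ) p) ↔ Ordered f p := by
  simp only [Ordered, Prod.map_fst, Prod.map_snd, h]

theorem exists_orders_eq_map : ∀ (σ : Equiv.Perm (Fin 3)) (n : Fin 18), ∃ m : Fin 18,
    lOrder m = Prod.map σ (Prod.map σ σ) (lOrder n) ∧
      zOrder m = Prod.map σ (Prod.map σ σ) (zOrder n) := by
  decide

theorem PhiStar_eq_of_isEigenfunction {T : ℝ} {u : ℝ → ℝ → ℝ} {k : ℂ} (hk : k ∈ domain T u)
    {Φ : ℝ → ℝ → Mat3} (hΦ : IsEigenfunction T u k Φ) {x t : ℝ} (hxt : (x, t) ∈ Omega T) :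
    PhiStar T u x t k = Φ x t := by
  obtain ⟨⟨n, hn⟩, hw⟩ := hk
  rw [PhiStar_eq T u n x t k hn, Phi, dif_pos ⟨hn, hw⟩]
  exact (hw.choose_spec.2 Φ hΦ x t hxt).symm

namespace IsSpectralSymmetry

variable {τ : ℂ ≃ₐ[ℝ] ℂ} {σ : Equiv.Perm (Fin 3)} {k k' : ℂ}

theorem exists_mem_D (h : IsSpectralSymmetry τ σ k k') (hk : ∃ n, k ∈ D n) : ∃ m, k' ∈ D m := by
  obtain ⟨n, hl, hz⟩ := hk
  obtain ⟨m, hml, hmz⟩ := exists_orders_eq_map σ n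
  refine ⟨m, ?_, ?_⟩
  · rw [hml]
    exact (ordered_map_iff (fun j ↦ by rw [h.l_eq, algEquiv_re]) _).2 hl
  · rw [hmz]
    exact (ordered_map_iff (fun j ↦ by rw [h.z_eq, algEquiv_re]) _).2 hz

theorem mem_domain (h : IsSpectralSymmetry τ σ k k') {T : ℝ} {u : ℝ → ℝ → ℝ}
    (hk : k ∈ domain T u) : k' ∈ domain T u :=
  ⟨h.exists_mem_D hk.1, h.wellDefined hk.2⟩

theorem PhiStar_eq_mapReindex (h : IsSpectralSymmetry τ σ k k') {T : ℝ} {u : ℝ → ℝ → ℝ}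
    (hk : k ∈ domain T u) {x t : ℝ} (hxt : (x, t) ∈ Omega T) :
    PhiStar T u x t k' = mapReindex τ σ (PhiStar T u x t k) := by
  obtain ⟨Φ, hΦ, -⟩ := hk.2
  rw [PhiStar_eq_of_isEigenfunction hk hΦ hxt,
    PhiStar_eq_of_isEigenfunction (h.mem_domain hk) (h.isEigenfunction_mapReindex hΦ) hxt]

end IsSpectralSymmetry

theorem omega_pow_three : omega ^ 3 = 1 := by
  simpa [omega] using (Complex.isPrimitiveRoot_exp 3 three_ne_zero).pow_eq_one

theorem conj_omega : conj omega = omega⁻¹ :=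
  (Complex.inv_eq_conj (Complex.norm_eq_one_of_pow_eq_one omega_pow_three three_ne_zero)).symm

theorem omega_pow_val_add_one (j : Fin 3) :
    omega ^ ((j + 1 : Fin 3).val + 1) = omega ^ (j.val + 1) * omega := by
  fin_cases j <;> simp [← pow_succ, ← sq, omega_pow_three]

theorem omega_pow_val_swap (j : Fin 3) :
    omega ^ ((Equiv.swap (0 : Fin 3) 1 j).val + 1) = (omega ^ (j.val + 1))⁻¹ := by
  refine eq_inv_of_mul_eq_one_left ?_
  fin_cases j <;>
    simp [Equiv.swap_apply_of_ne_of_ne, ← pow_succ, ← pow_succ', omega_pow_three]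

/-- The points `ω^j k`. The exponents `l_j` and `z_j` and the function `λ` depend on `k` only
through them. -/
noncomputable def branch (k : ℂ) (j : Fin 3) : ℂ := omega ^ (j.val + 1) * k

theorem branch_pow_three (k : ℂ) (j : Fin 3) : branch k j ^ 3 = k ^ 3 := by
  rw [branch, mul_pow, pow_right_comm, omega_pow_three, one_pow, one_mul]

theorem l_eq_branch (k : ℂ) (j : Fin 3) :
    l k j = 1 / (Real.sqrt 3 : ℂ) * (branch k j + 1 / branch k j) :=
  rfl

theorem z_eq_branch (k : ℂ) (j : Fin 3) :
    z k j = (Real.sqrt 3 : ℂ) * ((branch k j ^ 2 + 1 / branch k j ^ 2) /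
      (branch k j ^ 3 + 1 / branch k j ^ 3)) := by
  rw [branch_pow_three, branch, z]

theorem lam_eq_branch (k : ℂ) (j : Fin 3) :
    lam k = 1 / (3 * (Real.sqrt 3 : ℂ)) * (branch k j ^ 3 + 1 / branch k j ^ 3) := by
  rw [branch_pow_three, lam]

theorem isSpectralSymmetry_of_branch {τ : ℂ ≃ₐ[ℝ] ℂ} {σ : Equiv.Perm (Fin 3)} {k k' : ℂ}
    (h : ∀ j, branch k' (σ j) = τ (branch k j) ∨ branch k' (σ j) = (τ (branch k j))⁻¹) :
    IsSpectralSymmetry τ σ k k' where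
  l_eq j := by
    obtain hj | hj := h j <;> simp [l_eq_branch, hj, algEquiv_ofReal, add_comm]
  z_eq j := by
    obtain hj | hj := h j <;> simp [z_eq_branch, hj, algEquiv_ofReal, add_comm]
  lam_eq := by
    rw [lam_eq_branch k 0, lam_eq_branch k' (σ 0)]
    obtain hj | hj := h 0 <;> simp [hj, map_ofNat, algEquiv_ofReal, add_comm]

theorem isSpectralSymmetry_omega_mul (k : ℂ) :
    IsSpectralSymmetry AlgEquiv.refl (Equiv.addRight 1) (omega * k) k :=
  isSpectralSymmetry_of_branch fun j ↦ .inl <| by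
    simp only [branch, Equiv.coe_addRight, omega_pow_val_add_one, mul_assoc,
      AlgEquiv.coe_refl, id_eq]

theorem isSpectralSymmetry_conj (k : ℂ) :
    IsSpectralSymmetry Complex.conjAe (Equiv.swap 0 1) (conj k) k :=
  isSpectralSymmetry_of_branch fun j ↦ .inl <| by
    simp only [branch, omega_pow_val_swap, Complex.conjAe_coe, map_mul, map_pow,
      conj_omega, inv_pow, Complex.conj_conj]

theorem isSpectralSymmetry_one_div (k : ℂ) :
    IsSpectralSymmetry AlgEquiv.refl (Equiv.swap 0 1) (1 / k) k :=
  isSpectralSymmetry_of_branch fun j ↦ .inr <| by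
    simp only [branch, omega_pow_val_swap, AlgEquiv.coe_refl, id_eq, one_div, mul_inv, inv_inv]

theorem A_eq_permMatrix : A = (Equiv.addRight (1 : Fin 3))⁻¹.permMatrix ℂ := by
  ext i j
  fin_cases i <;> fin_cases j <;> rfl

theorem B_eq_permMatrix : B = (Equiv.swap (0 : Fin 3) 1).permMatrix ℂ := by
  ext i j
  fin_cases i <;> fin_cases j <;> rfl

theorem A_mul_mul_inv (M : Mat3) :
    A * M * A⁻¹ = mapReindex (AlgEquiv.refl : ℂ ≃ₐ[ℝ] ℂ) (Equiv.addRight 1) M := by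
  rw [A_eq_permMatrix, permMatrix_inv, inv_inv, permMatrix_conj]
  rfl

theorem B_mul_map_mul (τ : ℂ ≃ₐ[ℝ] ℂ) (M : Mat3) :
    B * M.map τ * B = mapReindex τ (Equiv.swap 0 1) M := by
  rw [B_eq_permMatrix]
  exact permMatrix_conj (Equiv.swap 0 1) (M.map τ)

end DPHalfLine

open DPHalfLine in
theorem mainTheorem8_general (T : ℝ) (u : ℝ → ℝ → ℝ) (k : ℂ) (hk : k ∈ domain T u) :
    (omega * k ∈ domain T u ∧ conj k ∈ domain T u ∧ 1 / k ∈ domain T u) ∧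
    ∀ x t : ℝ, (x, t) ∈ Omega T →
      PhiStar T u x t k = A * PhiStar T u x t (omega * k) * A⁻¹ ∧
      PhiStar T u x t k = B * (PhiStar T u x t (conj k)).map conj * B ∧
      PhiStar T u x t k = B * PhiStar T u x t (1 / k) * B := by
  have hω := isSpectralSymmetry_omega_mul k
  have hconj := isSpectralSymmetry_conj k
  have hinv := isSpectralSymmetry_one_div k
  have hωk := hω.symm.mem_domain hk
  have hconjk := hconj.symm.mem_domain hk
  have hinvk := hinv.symm.mem_domain hk
  refine ⟨⟨hωk, hconjk, hinvk⟩, fun x t hxt ↦ ⟨?_, ?_, ?_⟩⟩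
  · rw [A_mul_mul_inv, hω.PhiStar_eq_mapReindex hωk hxt]
  · exact (hconj.PhiStar_eq_mapReindex hconjk hxt).trans (B_mul_map_mul Complex.conjAe _).symm
  · exact (hinv.PhiStar_eq_mapReindex hinvk hxt).trans (B_mul_map_mul AlgEquiv.refl _).symm

theorem mainTheorem8 (T : ℝ) (hT : 0 < T) (u : ℝ → ℝ → ℝ) (hu : DPHalfLine.IsDPSolution T u)
    (k : ℂ) (hk : k ∈ DPHalfLine.domain T u) :
    (DPHalfLine.omega * k ∈ DPHalfLine.domain T u ∧
      conj k ∈ DPHalfLine.domain T u ∧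
      1 / k ∈ DPHalfLine.domain T u) ∧
    ∀ x t : ℝ, (x, t) ∈ DPHalfLine.Omega T →
      DPHalfLine.PhiStar T u x t k =
          DPHalfLine.A * DPHalfLine.PhiStar T u x t (DPHalfLine.omega * k) * DPHalfLine.A⁻¹ ∧
      DPHalfLine.PhiStar T u x t k =
          DPHalfLine.B * (DPHalfLine.PhiStar T u x t (conj k)).map conj * DPHalfLine.B ∧
      DPHalfLine.PhiStar T u x t k =
          DPHalfLine.B * DPHalfLine.PhiStar T u x t (1 / k) * DPHalfLine.B :=
  mainTheorem8_general T u k hk
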